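/- Let $\mathcal H$ be a complex Hilbert space and let $G$ be a metric operator in $\mathcal H$, that is, a self-adjoint operator, bounded or not, with $\langle G\xi,\xi\rangle\ge 0$ for all $\xi\in D(G)$ and $\langle G\xi,\xi\rangle=0$ only for $\xi=0$. Put $S=G^{-1/2}$ if $G$ is bounded; $S=G^{1/2}$ if $G^{-1}$ is bounded; and $S=(I+G)^{1/2}$ or $S=(I+G^{-1})^{1/2}$ if $G$ and $G^{-1}$ are both unbounded. In each case $S$ is a positive self-adjoint operator with bounded inverse. Let $V_{\mathcal G}=\{\mathcal H_n: n\in\mathbb Z\}$ be the Hilbert scale built on the powers of $S$: for $n\ge 0$, $\mathcal H_n=D(S^n)$ with the norm $\|S^n\xi\|$, and $\mathcal H_{-n}=\mathcal H_n^\times$ is its conjugate dual, so that $\mathcal H_0=\mathcal H$ and $\mathcal H_m\subset\mathcal H_n$ for $n\le m$. Let $\langle f,g\rangle=\langle S^{-n}f,S^{n}g\rangle_{\mathcal H}$ ($f\in\mathcal H_{-n}$, $g\in\mathcal H_n$) be the partial inner product. An operator in $V_{\mathcal G}$ is a linear map $A:D(A)\to\bigcup_n\mathcal H_n$, where $D(A)=\bigcup_{r\in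 d}\mathcal H_r$ for a non-empty set $d\subset\mathbb Z$, such that for each $r\in d$ some $u\in\mathbb Z$ exists for which $A$ maps $\mathcal H_r$ continuously into $\mathcal H_u$, and such that $A$ has no proper extension with these properties. If $A$ maps $\mathcal H_r$ continuously into $\mathcal H_u$, its restriction $A_{ur}:\mathcal H_r\to\mathcal H_u$ is called a representative of $A$. The adjoint $A^\times$ is the operator in $V_{\mathcal G}$ that has, for every representative $A_{ur}$ of $A$, a representative $(A^\times)_{-r,-u}:\mathcal H_{-u}\to\mathcal H_{-r}$ with $\langle A^\times y,x\rangle=\langle y,Ax\rangle$ for $x\in\mathcal H_r$, $y\in\mathcal H_{-u}$. The operator $A$ is symmetric if $A=A^\times$. **Theorem.** Let $A=A^\times$ be a symmetric operator in $V_{\mathcal G}$. Assume that there are $\lambda\in\mathbb R$ and $m,n\in\mathbb Z$ with $\mathcal H_m\subset\mathcal H_n$ such that $A-\lambda I$ has a boundedly invertible representative $(A-\lambda I)_{nm}:\mathcal H_m\to\mathcal H_n$. Let $F=A_{nm}$ if $\mathcal H\subset\mathcal H_n$, and $F=A$ if $\mathcal H_n\subset\mathcal H$ (if both inclusions hold,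 either choice is allowed). (i) $F$ has a unique restriction to a self-adjoint operator $\mathsf A$ in the Hilbert space $\mathcal H$. Its domain is dense and equals $D(\mathsf A)=\{\xi\in\mathcal H\cap D(F): F\xi\in\mathcal H\}$. In addition, $\lambda\in\rho(\mathsf A)$. (ii) If the natural embedding $\mathcal H_m\to\mathcal H_n$ is compact, then $\mathsf A$ has a purely point spectrum of finite multiplicity: $\sigma(\mathsf A)=\sigma_p(\mathsf A)$, every eigenvalue of $\mathsf A$ has a finite-dimensional eigenspace, and $\sigma_c(\mathsf A)=\emptyset$, where $\sigma_c(\mathsf A)$ is the set of the $z\in\mathbb C$ for which $\mathsf A-zI$ is injective with dense range different from $\mathcal H$. -/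

import Mathlib

open scoped InnerProductSpace

noncomputable section

/-! ### Unbounded operators in a Hilbert space -/

namespace PipKLMN

section Unbounded

variable {H : Type*} [NormedAddCommGroup H] [InnerProductSpace ℂ H] [CompleteSpace H]

/-- A metric operator: a strictly positive self-adjoint operator, bounded or not. -/
structure IsMetricOperator (G : H →ₗ.[ℂ] H) : Prop where
  selfAdjoint : IsSelfAdjoint G
  nonneg : ∀ ξ : G.domain, 0 ≤ (⟪G ξ, (ξ : H)⟫_ℂ).re
  eq_zero_iff : ∀ ξ : G.domain, ⟪G ξ, (ξ : H)⟫_ℂ = 0 ↔ ξ = 0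

/-- Boundedness of a partially defined operator on its domain. -/
def IsBddOperator (T : H →ₗ.[ℂ] H) : Prop :=
  ∃ C : ℝ, ∀ ξ : T.domain, ‖T ξ‖ ≤ C * ‖(ξ : H)‖

/-- The operator `T - z`, defined on the domain of `T`. -/
def subScalar (T : H →ₗ.[ℂ] H) (z : ℂ) : T.domain →ₗ[ℂ] H :=
  T.toFun - z • T.domain.subtype

/-- The resolvent set: `T - z` is a bijection of the domain of `T` onto `H`, with an inverse that
is bounded on `H`. -/
def resolventSet (T : H →ₗ.[ℂ] H) : Set ℂ :=
  {z | ∃ (R : H →L[ℂ] H) (hR : ∀ y, R y ∈ T.domain),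
    (∀ y, subScalar T z ⟨R y, hR y⟩ = y) ∧ ∀ x : T.domain, R (subScalar T z x) = x}

/-- The spectrum. -/
def spectrumSet (T : H →ₗ.[ℂ] H) : Set ℂ := (resolventSet T)ᶜ

/-- The point spectrum, that is, the set of eigenvalues. -/
def pointSpectrum (T : H →ₗ.[ℂ] H) : Set ℂ :=
  {z | ¬ Function.Injective (subScalar T z)}

/-- The continuous spectrum: `T - z` is injective, and its range is dense but not all of `H`. -/
def contSpectrum (T : H →ₗ.[ℂ] H) : Set ℂ :=
  {z | Function.Injective (subScalar T z) ∧ DenseRange (subScalar T z) ∧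
    ¬ Function.Surjective (subScalar T z)}

/-- The eigenspace of `T` for `z`; its dimension is the multiplicity of `z`. -/
def eigenspace (T : H →ₗ.[ℂ] H) (z : ℂ) : Submodule ℂ T.domain :=
  LinearMap.ker (subScalar T z)

end Unbounded

/-! ### The Hilbert scale -/

/-- A bounded metric operator `B`. The scale below is built on the powers of the operator
`S = B⁻¹`, which is a metric operator with bounded inverse. -/
structure BddMetric (H : Type*) [NormedAddCommGroup H] [InnerProductSpace ℂ H]
    [CompleteSpace H] where
  op : H →L[ℂ] H
  pos : op.IsPositive
  inj : Function.Injective op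

section Generator

variable {H : Type*} [NormedAddCommGroup H] [InnerProductSpace ℂ H] [CompleteSpace H]

/-- `B = P^{-1/2}`, that is, the positive bounded operator `B` satisfies `B² = P⁻¹`. -/
def IsInvSqrt (P : H →ₗ.[ℂ] H) (B : BddMetric H) : Prop :=
  P.inverse = ((B.op ∘L B.op : H →L[ℂ] H) : H →ₗ[ℂ] H).toPMap ⊤

/-- The operator `I + P`. -/
def onePlus (P : H →ₗ.[ℂ] H) : H →ₗ.[ℂ] H :=
  (LinearMap.id : H →ₗ[ℂ] H) +ᵥ P

/-- `S = B⁻¹` is the operator on whose powers the scale attached to `G` is built: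
`S = G^{-1/2}` if `G` is bounded, `S = G^{1/2}` if `G⁻¹` is bounded, and
`S = (I + G)^{1/2}` or `S = (I + G⁻¹)^{1/2}` if `G` and `G⁻¹` are both unbounded. -/
def IsScaleGenerator (G : H →ₗ.[ℂ] H) (B : BddMetric H) : Prop :=
  (IsBddOperator G ∧ IsInvSqrt G.inverse B) ∨
  (IsBddOperator G.inverse ∧ IsInvSqrt G B) ∨
  (¬ IsBddOperator G ∧ ¬ IsBddOperator G.inverse ∧
    (IsInvSqrt (onePlus G) B ∨ IsInvSqrt (onePlus G.inverse) B))

end Generator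

namespace BddMetric

variable {H : Type*} [NormedAddCommGroup H] [InnerProductSpace ℂ H] [CompleteSpace H]
variable (B : BddMetric H)

/-- The smallest space `H_∞ = ⋂ₙ D(Sⁿ)` of the scale; note that `D(Sⁿ)` is the range of `Bⁿ`. -/
def core : Submodule ℂ H := ⨅ n : ℕ, LinearMap.range ((B.op ^ n : H →L[ℂ] H) : H →ₗ[ℂ] H)

theorem mem_core {x : H} : x ∈ B.core ↔ ∀ n : ℕ, ∃ y, (B.op ^ n) y = x := by
  rw [core, Submodule.mem_iInf]
  exact Iff.rfl

theorem op_mem_core {x : H} (hx : x ∈ B.core) : B.op x ∈ B.core := by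
  rw [mem_core] at hx ⊢
  intro n
  obtain ⟨y, rfl⟩ := hx n
  refine ⟨B.op y, ?_⟩
  rw [← mul_apply_eq_comp, ← mul_apply_eq_comp, pow_mul_comm']

/-- The operator `S⁻¹ = B`, as a bijection of `H_∞`. -/
def coreEquiv : B.core ≃ₗ[ℂ] B.core :=
  LinearEquiv.ofBijective
    ((B.op : H →ₗ[ℂ] H).restrict (p := B.core) (q := B.core) fun _ hx => B.op_mem_core hx) <| by
    constructor
    · intro x y h
      exact Subtype.ext (B.inj (congrArg Subtype.val h))
    · rintro ⟨x, hx⟩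
      obtain ⟨y, hy⟩ := B.mem_core.1 hx 1
      refine ⟨⟨y, B.mem_core.2 fun n => ?_⟩, Subtype.ext (by simpa using hy)⟩
      obtain ⟨z, hz⟩ := B.mem_core.1 hx (n + 1)
      refine ⟨z, B.inj ?_⟩
      rw [pow_succ', mul_apply_eq_comp] at hz
      rw [hz, ← hy, pow_one]

theorem dense_core : Dense (B.core : Set H) := by
  have hsa : IsSelfAdjoint B.op := B.pos.isSelfAdjoint
  -- a continuous function of `B` that vanishes near `0` maps `H` into `H_∞`
  have key : ∀ ε : ℝ, 0 < ε → ∀ x : H, ∃ y ∈ B.core, ‖B.op x - y‖ ≤ ε * ‖x‖ := by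
    intro ε hε x
    -- `f` approximates the identity and vanishes on `[-ε, ε]`
    let f : ℝ → ℝ := fun t => t - max (-ε) (min ε t)
    have hf : Continuous f := by fun_prop
    refine ⟨cfc f B.op x, B.mem_core.2 fun n => ?_, ?_⟩
    · let g : ℝ → ℝ := fun t => (t / max (t ^ 2) (ε ^ 2)) ^ n * f t
      have hpos : ∀ t : ℝ, max (t ^ 2) (ε ^ 2) ≠ 0 := fun t =>
        (lt_of_lt_of_le (by positivity) (le_max_right _ _)).ne'
      have hg : Continuous g := by
        refine Continuous.mul (Continuous.pow ?_ n) hf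
        exact continuous_id.div (by fun_prop) hpos
      have hfg : f = fun t => t ^ n * g t := by
        funext t
        by_cases ht : |t| ≤ ε
        · have : f t = 0 := by
            have h1 := abs_le.1 ht
            simp [f, min_eq_right h1.2, max_eq_right h1.1]
          simp [g, this]
        · have h1 : ε ^ 2 ≤ t ^ 2 := by
            rw [← sq_abs t]
            exact pow_le_pow_left₀ hε.le (not_le.1 ht).le 2
          have h2 : t ≠ 0 := by
            rintro rfl
            simp at ht
            linarith
          have h3 : t * (t / max (t ^ 2) (ε ^ 2)) = 1 := by
            rw [max_eq_left h1]
            field_simp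
          simp only [g]
          rw [← mul_assoc, ← mul_pow, h3, one_pow, one_mul]
      refine ⟨cfc g B.op x, ?_⟩
      rw [← mul_apply_eq_comp]
      congr 1
      rw [hfg, cfc_mul (fun t : ℝ => t ^ n) g B.op (by fun_prop) hg.continuousOn,
        cfc_pow_id B.op n]
    · have h1 : B.op - cfc f B.op = cfc (fun t : ℝ => max (-ε) (min ε t)) B.op := by
        conv_lhs => rw [← cfc_id ℝ B.op]
        rw [cfc_id ℝ B.op]
        nth_rewrite 1 [← cfc_id ℝ B.op]
        rw [← cfc_sub _ _ B.op (by fun_prop) hf.continuousOn]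
        congr 1
        funext t
        simp [f]
      have h2 : ‖B.op - cfc f B.op‖ ≤ ε := by
        rw [h1]
        refine norm_cfc_le hε.le fun t _ => ?_
        rw [Real.norm_eq_abs, abs_le]
        exact ⟨le_max_left _ _, max_le (by linarith) (min_le_left _ _)⟩
      calc ‖B.op x - cfc f B.op x‖ = ‖(B.op - cfc f B.op) x‖ := by simp
        _ ≤ ‖B.op - cfc f B.op‖ * ‖x‖ := ContinuousLinearMap.le_opNorm _ _
        _ ≤ ε * ‖x‖ := by gcongr
  have hrange : ∀ x : H, B.op x ∈ closure (B.core : Set H) := by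
    intro x
    rw [Metric.mem_closure_iff]
    intro δ hδ
    obtain ⟨y, hy, hxy⟩ := key (δ / (‖x‖ + 1)) (by positivity) x
    refine ⟨y, hy, ?_⟩
    rw [dist_eq_norm]
    refine lt_of_le_of_lt hxy ?_
    rw [div_mul_eq_mul_div, div_lt_iff₀ (by positivity)]
    nlinarith [norm_nonneg x]
  have horth : (B.core.topologicalClosure)ᗮ = ⊥ := by
    rw [Submodule.eq_bot_iff]
    intro v hv
    apply B.inj
    rw [map_zero]
    have h := (Submodule.mem_orthogonal _ _).1 hv (B.op (B.op v)) (hrange _)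
    rw [← ContinuousLinearMap.adjoint_inner_right, hsa.adjoint_eq, inner_self_eq_zero] at h
    exact h
  rw [Submodule.orthogonal_closure] at horth
  exact Submodule.dense_iff_topologicalClosure_eq_top.2
    (Submodule.topologicalClosure_eq_top_iff.2 horth)

/-- The space of all antilinear functionals on `H_∞`, in which all spaces of the scale live. -/
abbrev Ambient : Type _ := B.core →ₗ⋆[ℂ] ℂ

/-- The map `S⁻ⁿ : H → H_n` for an integer `n`: the vector `S⁻ⁿ η` is the functional
`φ ↦ ⟪S⁻ⁿ φ, η⟫` on `H_∞`. For `n = 0` this is the embedding of `H`; for `n ≥ 0` it is the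
embedding of the vector `Bⁿ η` of `D(Sⁿ)`; for `n = -k < 0` it is, by the Riesz theorem, the
general form of a bounded antilinear functional on `H_k`. -/
def unitary (n : ℤ) : H →ₗ[ℂ] B.Ambient where
  toFun η :=
    { toFun := fun φ => ⟪(((B.coreEquiv ^ n) φ : B.core) : H), η⟫_ℂ
      map_add' := fun φ ψ => by simp
      map_smul' := fun c φ => by simp [mul_comm] }
  map_add' η ζ := by ext φ; simp
  map_smul' c η := by ext φ; simp

theorem unitary_apply (n : ℤ) (η : H) (φ : B.core) :
    B.unitary n η φ = ⟪(((B.coreEquiv ^ n) φ : B.core) : H), η⟫_ℂ := rfl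

theorem unitary_injective (n : ℤ) : Function.Injective (B.unitary n) := by
  rw [injective_iff_map_eq_zero]
  intro η h
  refine B.dense_core.eq_zero_of_inner_right (𝕜 := ℂ) fun v hv => ?_
  have h1 := LinearMap.congr_fun h ((B.coreEquiv ^ n).symm ⟨v, hv⟩)
  rw [unitary_apply, LinearEquiv.apply_symm_apply] at h1
  exact h1

/-- The space `H_n = S⁻ⁿ H` of the scale, `n ∈ ℤ`. -/
def space (n : ℤ) : Submodule ℂ B.Ambient := LinearMap.range (B.unitary n)

/-- The operator `Sⁿ : H_n → H`. -/
def coord (n : ℤ) : B.space n ≃ₗ[ℂ] H :=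
  (LinearEquiv.ofInjective (B.unitary n) (B.unitary_injective n)).symm

/-- The norm `‖f‖_n = ‖Sⁿ f‖` of `H_n`. -/
instance instNormedAddCommGroupSpace (n : ℤ) : NormedAddCommGroup (B.space n) :=
  NormedAddCommGroup.induced (B.space n) H (B.coord n) (B.coord n).injective

theorem norm_space (n : ℤ) (f : B.space n) : ‖f‖ = ‖B.coord n f‖ := rfl

instance instInnerProductSpaceSpace (n : ℤ) : InnerProductSpace ℂ (B.space n) where
  inner f g := ⟪B.coord n f, B.coord n g⟫_ℂ
  norm_smul_le c f := by simp [norm_space, norm_smul]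
  norm_sq_eq_re_inner f := by
    rw [norm_space]
    exact norm_sq_eq_re_inner (B.coord n f)
  conj_inner_symm f g := inner_conj_symm _ _
  add_left f g h := by simp
  smul_left f g c := by simp [mul_comm]

/-- The partial inner product `⟪f, g⟫ = ⟪S⁻ⁿ f, Sⁿ g⟫` of `f ∈ H_{-n}` and `g ∈ H_n`. -/
def pip (n : ℤ) (f : B.space (-n)) (g : B.space n) : ℂ := ⟪B.coord (-n) f, B.coord n g⟫_ℂ

/-- The embedding of the central Hilbert space `H` in the scale; its range is `H_0`. -/
def central : H →ₗ[ℂ] B.Ambient := B.unitary 0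

/-! ### Operators in the scale -/

/-- `T` is the representative `A_{ur} : H_r → H_u` of `A`. -/
def IsRep (A : B.Ambient →ₗ.[ℂ] B.Ambient) (r u : ℤ) (T : B.space r →L[ℂ] B.space u) : Prop :=
  ∀ x : B.space r, ∃ h : (x : B.Ambient) ∈ A.domain, A ⟨x, h⟩ = (T x : B.Ambient)

/-- The domain of `A` is the union of the spaces `H_r`, `r ∈ d`, where `d` is a non-empty set of
integers, and `A` maps each of these spaces continuously into some `H_u`. -/
def IsPreOp (A : B.Ambient →ₗ.[ℂ] B.Ambient) : Prop :=
  ∃ d : Set ℤ, d.Nonempty ∧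
    (A.domain : Set B.Ambient) = ⋃ r ∈ d, (B.space r : Set B.Ambient) ∧
    ∀ r ∈ d, ∃ (u : ℤ) (T : B.space r →L[ℂ] B.space u), B.IsRep A r u T

/-- `A` belongs to `Op(V)`, where `V` is the scale: it satisfies the preceding conditions, and has
no proper extension that satisfies them. -/
def IsOp (A : B.Ambient →ₗ.[ℂ] B.Ambient) : Prop :=
  B.IsPreOp A ∧ ∀ A', B.IsPreOp A' → A ≤ A' → A' = A

/-- `A'` is the adjoint `A^×` of `A`: whenever `A` has a representative `A_{ur}`, `A'` has a
representative `A'_{-r,-u}`, and `⟪A' y, x⟫ = ⟪y, A x⟫` for `x ∈ H_r` and `y ∈ H_{-u}`. -/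
def IsAdjoint (A A' : B.Ambient →ₗ.[ℂ] B.Ambient) : Prop :=
  B.IsOp A ∧ B.IsOp A' ∧
    ∀ (r u : ℤ) (T : B.space r →L[ℂ] B.space u), B.IsRep A r u T →
      ∃ T' : B.space (-u) →L[ℂ] B.space (-r), B.IsRep A' (-u) (-r) T' ∧
        ∀ (x : B.space r) (y : B.space (-u)), B.pip r (T' y) x = B.pip u y (T x)

/-- `A` is a symmetric operator in the scale, `A = A^×`. -/
def IsSymmetricOp (A : B.Ambient →ₗ.[ℂ] B.Ambient) : Prop := B.IsAdjoint A A

/-- `T - z : H_r → H_u` is boundedly invertible, where `H_r ⊆ H_u`. -/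
def IsBddInvertible {r u : ℤ} (T : B.space r →L[ℂ] B.space u) (z : ℂ)
    (h : B.space r ≤ B.space u) : Prop :=
  ∃ R : B.space u →L[ℂ] B.space r,
    (∀ x, R (T x - z • Submodule.inclusion h x) = x) ∧
    (∀ y, T (R y) - z • Submodule.inclusion h (R y) = y)

/-- The operator `a` in `H` is a restriction of `F`. -/
def IsRestriction (a : H →ₗ.[ℂ] H) (F : B.Ambient →ₗ.[ℂ] B.Ambient) : Prop :=
  ∀ ξ : a.domain, ∃ h : B.central ξ ∈ F.domain, F ⟨B.central ξ, h⟩ = B.central (a ξ)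

/-- The set `{ξ ∈ H : F ξ ∈ H}`. -/
def domainInH (F : B.Ambient →ₗ.[ℂ] B.Ambient) : Set H :=
  {ξ | ∃ h : B.central ξ ∈ F.domain, F ⟨B.central ξ, h⟩ ∈ B.space 0}

end BddMetric

end PipKLMN

end

/-!
Let `R : H_n → H_m` be the inverse of the given representative of `A - lam`. By symmetry of `A` its
adjoint `R' : H_{-m} → H_{-n}` for the partial inner product inverts another representative of
`A - lam`, so that `R` and `R'` agree wherever both are defined. Hence one of them restricts to an
operator on a space `H_k ⊆ H` that is symmetric for the inner product of `H`, and a bounded operator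
with this property extends to a bounded self-adjoint operator `M` on `H` (Krein, Lax). The part `a`
of `F` in `H` satisfies `(a - lam)⁻¹ = M`, so it is self-adjoint. It extends every restriction of
`F` to an operator in `H`, and self-adjoint operators have no proper self-adjoint extensions.

If `H_m → H_n` is compact and `H` is infinite-dimensional, then `n < m` and `C = S^{n-m}` is
compact. For a smooth spectral cutoff `E` of `C` to the interval of radius `ε` about `0`, the
operator `1 - E` is compact, and so is `M - E M E`. By the Krein–Lax estimate `‖E M E‖ = O(ε)`,
because `M` is induced by an operator on `H_m` or on `H_{-n}` that factors through `C`. Hence `M` is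
compact, and the eigenvalues of `M` determine the spectrum of `a`.
-/

noncomputable section

namespace PipKLMN

/-! ### Symmetrizable operators -/

theorem mul_le_mul_succ_of_sq_le_mul {a : ℕ → ℝ} (ha : ∀ n, 0 ≤ a n)
    (hconv : ∀ n, a (n + 1) ^ 2 ≤ a n * a (n + 2)) (n : ℕ) : a 1 * a n ≤ a 0 * a (n + 1) := by
  induction n with
  | zero => exact (mul_comm _ _).le
  | succ n ih =>
    rcases (ha n).eq_or_lt with h | h
    · have hzero : a (n + 1) = 0 := sq_nonpos_iff _ |>.1 (by simpa [← h] using hconv n)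
      simpa [hzero] using mul_nonneg (ha 0) (ha (n + 2))
    · refine le_of_mul_le_mul_left ?_ h
      calc a n * (a 1 * a (n + 1)) = a 1 * a n * a (n + 1) := by ring
        _ ≤ a 0 * a (n + 1) * a (n + 1) := by gcongr; exact ha _
        _ = a 0 * a (n + 1) ^ 2 := by ring
        _ ≤ a 0 * (a n * a (n + 2)) := by gcongr; exacts [ha 0, hconv n]
        _ = a n * (a 0 * a (n + 2)) := by ring

theorem pow_mul_le_pow_mul_of_sq_le_mul {a : ℕ → ℝ} (ha : ∀ n, 0 ≤ a n)
    (hconv : ∀ n, a (n + 1) ^ 2 ≤ a n * a (n + 2)) (n : ℕ) : a 1 ^ n * a 0 ≤ a 0 ^ n * a n := by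
  induction n with
  | zero => simp
  | succ n ih =>
    calc a 1 ^ (n + 1) * a 0 = a 1 * (a 1 ^ n * a 0) := by ring
      _ ≤ a 1 * (a 0 ^ n * a n) := mul_le_mul_of_nonneg_left ih (ha 1)
      _ = a 0 ^ n * (a 1 * a n) := by ring
      _ ≤ a 0 ^ n * (a 0 * a (n + 1)) := mul_le_mul_of_nonneg_left
        (mul_le_mul_succ_of_sq_le_mul ha hconv n) (pow_nonneg (ha 0) n)
      _ = a 0 ^ (n + 1) * a (n + 1) := by ring

theorem le_mul_of_sq_le_mul_of_le_mul_pow {a : ℕ → ℝ} {C r : ℝ} (ha : ∀ n, 0 ≤ a n)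
    (hconv : ∀ n, a (n + 1) ^ 2 ≤ a n * a (n + 2)) (hr : 0 ≤ r) (hbound : ∀ n, a n ≤ C * r ^ n) :
    a 1 ≤ r * a 0 := by
  rcases (ha 0).eq_or_lt with h0 | h0
  · have hzero : a 1 = 0 := sq_nonpos_iff _ |>.1 (by simpa [← h0] using hconv 0)
    simp [hzero, ← h0]
  by_contra! hlt
  have ha1 : 0 < a 1 := (mul_nonneg hr (ha 0)).trans_lt hlt
  have hlim : Filter.Tendsto (fun n : ℕ => C * (r * a 0 / a 1) ^ n) Filter.atTop (nhds 0) := by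
    simpa using (tendsto_pow_atTop_nhds_zero_of_lt_one (by positivity)
      ((div_lt_one ha1).2 hlt)).const_mul C
  refine h0.not_ge (ge_of_tendsto' hlim fun n => ?_)
  rw [div_pow, ← mul_div_assoc, le_div_iff₀ (by positivity), mul_comm]
  calc a 1 ^ n * a 0 ≤ a 0 ^ n * a n := pow_mul_le_pow_mul_of_sq_le_mul ha hconv n
    _ ≤ a 0 ^ n * (C * r ^ n) := mul_le_mul_of_nonneg_left (hbound n) (pow_nonneg h0.le n)
    _ = C * (r * a 0) ^ n := by ring

section Symmetrizable

variable {𝕜 H K : Type*} [RCLike 𝕜] [NormedAddCommGroup H] [InnerProductSpace 𝕜 H]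
  [SeminormedAddCommGroup K] [NormedSpace 𝕜 K]

/-- A lemma of Krein and Lax. The sequence `‖j (Lⁿ x)‖` is logarithmically convex by the
Cauchy–Schwarz inequality, and it grows at most like `‖L‖ⁿ`. -/
theorem norm_apply_le_of_symmetrizable (j : K →L[𝕜] H) (L : K →L[𝕜] K)
    (hL : ∀ x y, ⟪j (L x), j y⟫_𝕜 = ⟪j x, j (L y)⟫_𝕜) (x : K) : ‖j (L x)‖ ≤ ‖L‖ * ‖j x‖ := by
  refine le_mul_of_sq_le_mul_of_le_mul_pow (a := fun n => ‖j (L^[n] x)‖) (C := ‖j‖ * ‖x‖)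
    (fun _ => norm_nonneg _) (fun n => ?_) (norm_nonneg L) fun n => ?_
  · simp only [Function.iterate_succ_apply']
    calc ‖j (L (L^[n] x))‖ ^ 2 = ‖⟪j (L^[n] x), j (L (L (L^[n] x)))⟫_𝕜‖ := by
          rw [← hL, inner_self_eq_norm_sq_to_K, norm_pow, RCLike.norm_ofReal, abs_norm]
      _ ≤ _ := norm_inner_le_norm _ _
  · calc ‖j (L^[n] x)‖ ≤ ‖j‖ * (‖L‖ ^ n * ‖x‖) := j.le_opNorm_of_le <| by
          simpa using (L.lipschitz.iterate n).norm_le_mul (iterate_map_zero L n) x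
      _ = ‖j‖ * ‖x‖ * ‖L‖ ^ n := by ring

variable [CompleteSpace H] {j : K →L[𝕜] H}

theorem exists_isSelfAdjoint_of_symmetrizable (hj : DenseRange j) (L : K →L[𝕜] K)
    (hL : ∀ x y, ⟪j (L x), j y⟫_𝕜 = ⟪j x, j (L y)⟫_𝕜) :
    ∃ M : H →L[𝕜] H, IsSelfAdjoint M ∧ ∀ x, M (j x) = j (L x) := by
  let M := ((j ∘L L : K →L[𝕜] H) : K →ₗ[𝕜] H).extendOfNorm (j : K →ₗ[𝕜] H)
  have hM (x : K) : M (j x) = j (L x) :=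
    LinearMap.extendOfNorm_eq hj ⟨‖L‖, norm_apply_le_of_symmetrizable j L hL⟩ x
  refine ⟨M, ContinuousLinearMap.isSelfAdjoint_iff_isSymmetric.2 fun x y => ?_, hM⟩
  refine hj.induction_on₂ (p := fun x y => ⟪M x, y⟫_𝕜 = ⟪x, M y⟫_𝕜)
    (isClosed_eq (by fun_prop) (by fun_prop)) (fun x y => ?_) x y
  rw [hM, hM, hL]

theorem opNorm_le_of_isSelfAdjoint_of_intertwining (hj : DenseRange j) (L : K →L[𝕜] K)
    {M : H →L[𝕜] H} (hM : IsSelfAdjoint M) (hML : ∀ x, M (j x) = j (L x)) : ‖M‖ ≤ ‖L‖ := by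
  refine M.opNorm_le_bound (norm_nonneg L) fun x => ?_
  refine hj.induction_on (p := fun x => ‖M x‖ ≤ ‖L‖ * ‖x‖) x
    (isClosed_le (by fun_prop) (by fun_prop)) fun y => ?_
  rw [hML]
  refine norm_apply_le_of_symmetrizable j L (fun u v => ?_) y
  rw [← hML, ← hML]
  exact ContinuousLinearMap.isSelfAdjoint_iff_isSymmetric.1 hM _ _

theorem denseRange_of_isSelfAdjoint_of_injective {M : H →L[𝕜] H} (hM : IsSelfAdjoint M)
    (hinj : Function.Injective M) : DenseRange M := by
  change Dense ((LinearMap.range (M : H →ₗ[𝕜] H) : Submodule 𝕜 H) : Set H)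
  rw [Submodule.dense_iff_topologicalClosure_eq_top, Submodule.topologicalClosure_eq_top_iff]
  have h := M.orthogonal_range
  rw [hM.adjoint_eq, LinearMap.ker_eq_bot.2 hinj] at h
  exact h

end Symmetrizable

/-! ### Compactness through a spectral cutoff -/

section Cutoff

variable {H : Type*} [NormedAddCommGroup H] [InnerProductSpace ℂ H] [CompleteSpace H]

/-- The operators are `E = ε² (C² + ε²)⁻¹` and `W = C (C² + ε²)⁻¹`. -/
theorem exists_cutoff {C : H →L[ℂ] H} (hC : IsSelfAdjoint C) {ε : ℝ} (hε : 0 < ε) :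
    ∃ E W : H →L[ℂ] H, IsSelfAdjoint E ∧ ‖E‖ ≤ 1 ∧ ‖C * E‖ ≤ ε ∧ 1 - E = W * C ∧
      ∀ J, Commute C J → Commute E J := by
  have hpos (t : ℝ) : 0 < t ^ 2 + ε ^ 2 := by positivity
  let e : ℝ → ℝ := fun t => ε ^ 2 / (t ^ 2 + ε ^ 2)
  let w : ℝ → ℝ := fun t => t / (t ^ 2 + ε ^ 2)
  have he : Continuous e := continuous_const.div (by fun_prop) fun t => (hpos t).ne'
  have hw : Continuous w := continuous_id.div (by fun_prop) fun t => (hpos t).ne'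
  refine ⟨cfc e C, cfc w C, cfc_predicate e C, norm_cfc_le zero_le_one fun t _ => ?_, ?_, ?_,
    fun J hJ => hC.commute_cfc hJ e⟩
  · rw [Real.norm_eq_abs, abs_of_nonneg (by positivity), div_le_one (hpos t)]
    linarith [sq_nonneg t]
  · have hCE : C * cfc e C = cfc (fun t => t * e t) C := by
      rw [cfc_mul (fun t => t) e C continuousOn_id he.continuousOn, cfc_id' ℝ C hC]
    rw [hCE]
    refine norm_cfc_le hε.le fun t _ => ?_
    rw [Real.norm_eq_abs, abs_mul, abs_of_nonneg (show 0 ≤ e t by positivity), ← mul_div_assoc,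
      div_le_iff₀ (hpos t), ← sq_abs t]
    nlinarith [mul_nonneg hε.le (sq_nonneg (|t| - ε)), mul_nonneg hε.le (sq_nonneg |t|),
      pow_pos hε 3]
  · have hWC : cfc w C * C = cfc (fun t => w t * t) C := by
      rw [cfc_mul w (fun t => t) C hw.continuousOn continuousOn_id, cfc_id' ℝ C hC]
    rw [hWC, ← cfc_const_one ℝ C, ← cfc_sub _ e C continuousOn_const he.continuousOn]
    congr 1
    funext t
    simp only [e, w]
    field_simp [(hpos t).ne']
    ring

theorem isCompactOperator_of_intertwining {C J M X : H →L[ℂ] H} (hC : IsSelfAdjoint C)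
    (hCcpt : IsCompactOperator C) (hJ : DenseRange J) (hCJ : Commute C J) (hM : IsSelfAdjoint M)
    (hMX : M * J = J * (X * C)) : IsCompactOperator M := by
  refine (isClosed_setOfPred_isCompactOperator (𝕜₁ := ℂ) (𝕜₂ := ℂ) (σ₁₂ := RingHom.id ℂ)
    (M₁ := H) (M₂ := H)).closure_subset (Metric.mem_closure_iff.2 fun δ hδ => ?_)
  have hε : 0 < δ / (‖X‖ + 1) := by positivity
  obtain ⟨E, W, hE, hE1, hCE, hEW, hcomm⟩ := exists_cutoff hC hε
  have hEJ : E * J = J * E := hcomm J hCJ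
  have hcpt : IsCompactOperator (1 - E : H →L[ℂ] H) := hEW ▸ hCcpt.clm_comp W
  refine ⟨M - E * M * E, ?_, ?_⟩
  · have hsplit : M - E * M * E = (1 - E) * M + (E * M) * (1 - E) := by noncomm_ring
    rw [hsplit]
    exact (hcpt.comp_clm M).add (hcpt.clm_comp (E * M))
  · have hEME : IsSelfAdjoint (E * M * E) := by simpa [hE.star_eq] using hM.conjugate E
    have hint : E * M * E * J = J * (E * X * (C * E)) := by
      calc E * M * E * J = E * (M * J) * E := by simp only [mul_assoc, hEJ]
        _ = E * J * X * C * E := by rw [hMX]; simp only [mul_assoc]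
        _ = J * (E * X * (C * E)) := by rw [hEJ]; simp only [mul_assoc]
    rw [dist_eq_norm, sub_sub_cancel]
    calc ‖E * M * E‖ ≤ ‖E * X * (C * E)‖ :=
          opNorm_le_of_isSelfAdjoint_of_intertwining hJ _ hEME fun x => DFunLike.congr_fun hint x
      _ ≤ ‖E‖ * ‖X‖ * ‖C * E‖ := norm_mul₃_le
      _ ≤ 1 * ‖X‖ * (δ / (‖X‖ + 1)) := by gcongr
      _ < δ := by
        rw [one_mul, ← mul_div_assoc, div_lt_iff₀ (by positivity)]
        nlinarith

end Cutoff

/-! ### Resolvents and spectra of operators in `H` -/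

theorem mem_graph_iff_exists {𝕜 E E' : Type*} [Ring 𝕜] [AddCommGroup E] [Module 𝕜 E]
    [AddCommGroup E'] [Module 𝕜 E'] {f : E →ₗ.[𝕜] E'} {x : E} {y : E'} :
    (x, y) ∈ f.graph ↔ ∃ h : x ∈ f.domain, f ⟨x, h⟩ = y := by
  simp only [LinearPMap.mem_graph_iff, Subtype.exists, exists_and_left, exists_eq_left]

theorem mem_graph_domRestrict {𝕜 E E' : Type*} [Ring 𝕜] [AddCommGroup E] [Module 𝕜 E]
    [AddCommGroup E'] [Module 𝕜 E'] {f : E →ₗ.[𝕜] E'} {p : Submodule 𝕜 E} {x : E} {y : E'} :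
    (x, y) ∈ (f.domRestrict p).graph ↔ x ∈ p ∧ (x, y) ∈ f.graph := by
  rw [mem_graph_iff_exists, mem_graph_iff_exists]
  exact ⟨fun ⟨h, hy⟩ => ⟨h.1, h.2, hy⟩, fun ⟨hp, hf, hy⟩ => ⟨⟨hp, hf⟩, hy⟩⟩

theorem eq_of_le_of_isSelfAdjoint {𝕜 H : Type*} [RCLike 𝕜] [NormedAddCommGroup H]
    [InnerProductSpace 𝕜 H] [CompleteSpace H] {a b : H →ₗ.[𝕜] H} (ha : IsSelfAdjoint a)
    (hb : IsSelfAdjoint b) (h : b ≤ a) : b = a := by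
  refine le_antisymm h ?_
  have hform : b.IsFormalAdjoint a := fun x y => by
    have ha_form := LinearPMap.adjoint_isFormalAdjoint ha.dense_domain
    rw [LinearPMap.isSelfAdjoint_def.1 ha] at ha_form
    rw [h.2 (x := x) (y := ⟨x, h.1 x.2⟩) rfl]
    exact ha_form ⟨x, h.1 x.2⟩ y
  simpa only [LinearPMap.isSelfAdjoint_def.1 hb] using hform.le_adjoint hb.dense_domain

section Resolvent

variable {H : Type*} [NormedAddCommGroup H] [InnerProductSpace ℂ H] {a : H →ₗ.[ℂ] H}
  {z w : ℂ} {M : H →L[ℂ] H}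

/-- `M` is the resolvent `(a - z)⁻¹` of `a` at `z`. The equation `(a - z) x = y` is stated through
the graph of `a`, which makes the membership of `x` in the domain of `a` part of it. -/
def IsResolvent (a : H →ₗ.[ℂ] H) (z : ℂ) (M : H →L[ℂ] H) : Prop :=
  ∀ x y, M y = x ↔ (x, y + z • x) ∈ a.graph

theorem mem_graph_iff_subScalar_eq {x y : H} :
    (x, y + z • x) ∈ a.graph ↔ ∃ h : x ∈ a.domain, subScalar a z ⟨x, h⟩ = y :=
  mem_graph_iff_exists.trans (exists_congr fun _ => sub_eq_iff_eq_add.symm)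

theorem subScalar_bijective_of_mem_resolventSet (hz : z ∈ resolventSet a) :
    Function.Bijective (subScalar a z) := by
  obtain ⟨R, hR, hright, hleft⟩ := hz
  refine ⟨fun x y h => Subtype.ext ?_, fun y => ⟨⟨R y, hR y⟩, hright y⟩⟩
  rw [← hleft x, h, hleft y]

theorem spectrumSet_eq_pointSpectrum (h : ∀ z ∉ pointSpectrum a, z ∈ resolventSet a) :
    spectrumSet a = pointSpectrum a :=
  Set.ext fun z => ⟨fun hz => not_not.1 fun hz' => hz (h z hz'),
    fun hz hz' => hz (subScalar_bijective_of_mem_resolventSet hz').1⟩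

theorem contSpectrum_eq_empty (h : ∀ z ∉ pointSpectrum a, z ∈ resolventSet a) :
    contSpectrum a = ∅ :=
  Set.eq_empty_of_forall_notMem fun z hz =>
    hz.2.2 (subScalar_bijective_of_mem_resolventSet (h z (not_not.2 hz.1))).2

namespace IsResolvent

theorem injective (hM : IsResolvent a z M) : Function.Injective M := fun y y' h =>
  add_right_cancel (a.mem_graph_snd_inj ((hM _ y).1 h) ((hM _ y').1 rfl) rfl)

theorem apply_mem_domain (hM : IsResolvent a z M) (y : H) : M y ∈ a.domain :=
  a.mem_domain_of_mem_graph ((hM _ y).1 rfl)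

theorem mem_resolventSet (hM : IsResolvent a z M) : z ∈ resolventSet a :=
  ⟨M, hM.apply_mem_domain, fun y => (mem_graph_iff_subScalar_eq.1 ((hM _ y).1 rfl)).2,
    fun x => (hM _ _).2 (mem_graph_iff_subScalar_eq.2 ⟨x.2, rfl⟩)⟩

theorem one_sub_smul_apply_eq_iff (hM : IsResolvent a w M) {x y : H} :
    (1 - (z - w) • M) x = M y ↔ (x, y + z • x) ∈ a.graph := by
  have hshift : y + z • x = (y + (z - w) • x) + w • x := by module
  rw [hshift, ← hM, map_add, map_smul, ← eq_sub_iff_add_eq]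
  exact eq_comm

theorem mem_resolventSet_of_isUnit (hM : IsResolvent a w M) (h : IsUnit (1 - (z - w) • M)) :
    z ∈ resolventSet a := by
  obtain ⟨u, hu⟩ := h
  refine IsResolvent.mem_resolventSet (M := ↑u⁻¹ * M) fun x y => ?_
  rw [← hM.one_sub_smul_apply_eq_iff, ← hu]
  exact ⟨fun h => h ▸ DFunLike.congr_fun (u.mul_inv_cancel_left M) y,
    fun h => by rw [mul_apply_eq_comp, ← h, ← mul_apply_eq_comp, u.inv_mul, one_apply_eq_self]⟩

theorem apply_smul_of_subScalar_eq_zero (hM : IsResolvent a w M) {x : a.domain}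
    (hx : subScalar a z x = 0) : ((z - w) • M) x = x := by
  have h := hM.one_sub_smul_apply_eq_iff.2 (mem_graph_iff_subScalar_eq.2 ⟨x.2, hx⟩)
  rw [map_zero] at h
  exact (sub_eq_zero.1 h).symm

theorem mem_pointSpectrum_of_hasEigenvalue (hM : IsResolvent a w M)
    (h : Module.End.HasEigenvalue (((z - w) • M : H →L[ℂ] H) : Module.End ℂ H) 1) :
    z ∈ pointSpectrum a := by
  obtain ⟨v, hv⟩ := h.exists_hasEigenvector
  have hv1 : (1 - (z - w) • M) v = M 0 := by
    rw [map_zero]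
    exact sub_eq_zero.2 (hv.apply_eq_smul.trans (one_smul ℂ v)).symm
  obtain ⟨hmem, hzero⟩ := mem_graph_iff_subScalar_eq.1 (hM.one_sub_smul_apply_eq_iff.1 hv1)
  intro hinj
  exact hv.2 (congrArg Subtype.val (hinj (hzero.trans (map_zero _).symm)))

variable [CompleteSpace H]

theorem mem_resolventSet_of_notMem_pointSpectrum (hM : IsResolvent a w M)
    (hcpt : IsCompactOperator M) (hz : z ∉ pointSpectrum a) : z ∈ resolventSet a := by
  rcases (hcpt.smul (z - w)).hasEigenvalue_or_mem_resolventSet (T := (z - w) • M)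
    (one_ne_zero (α := ℂ)) with h | h
  · exact absurd (hM.mem_pointSpectrum_of_hasEigenvalue h) hz
  · exact hM.mem_resolventSet_of_isUnit (by simpa [spectrum.mem_resolventSet_iff] using h)

theorem finiteDimensional_eigenspace (hM : IsResolvent a w M) (hcpt : IsCompactOperator M)
    (z : ℂ) : FiniteDimensional ℂ (eigenspace a z) := by
  have := ContinuousLinearMap.finite_dimensional_eigenspace (T := (z - w) • M)
    (hcpt.smul (z - w)) 1 one_ne_zero
  let ι : eigenspace a z →ₗ[ℂ] H := a.domain.subtype ∘ₗ (eigenspace a z).subtype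
  have hι : Function.Injective ι := Subtype.val_injective.comp Subtype.val_injective
  refine FiniteDimensional.of_injective (ι.codRestrict (Module.End.eigenspace
    (((z - w) • M : H →L[ℂ] H) : Module.End ℂ H) 1) fun x => ?_)
    ((LinearMap.injective_codRestrict_iff _).2 hι)
  rw [Module.End.mem_eigenspace_iff, one_smul]
  exact hM.apply_smul_of_subScalar_eq_zero x.2

theorem isSelfAdjoint {lam : ℝ} (hM : IsResolvent a lam M) (hsa : IsSelfAdjoint M) :
    IsSelfAdjoint a := by
  have hdense : Dense (a.domain : Set H) :=
    (denseRange_of_isSelfAdjoint_of_injective hsa hM.injective).mono <| by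
      rintro _ ⟨y, rfl⟩
      exact hM.apply_mem_domain y
  have hsymm (x y : H) : ⟪M x, y⟫_ℂ = ⟪x, M y⟫_ℂ :=
    ContinuousLinearMap.isSelfAdjoint_iff_isSymmetric.1 hsa x y
  rw [LinearPMap.isSelfAdjoint_def]
  refine LinearPMap.eq_of_eq_graph (Submodule.ext fun ⟨x, y⟩ => ?_)
  obtain ⟨y, rfl⟩ : ∃ y', y = y' + (lam : ℂ) • x := ⟨y - (lam : ℂ) • x, by module⟩
  rw [LinearPMap.adjoint_graph_eq_graph_adjoint hdense, Submodule.mem_adjoint_iff, ← hM]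
  calc (∀ u v, (u, v) ∈ a.graph → ⟪v, x⟫_ℂ - ⟪u, y + (lam : ℂ) • x⟫_ℂ = 0)
      ↔ ∀ h, ⟪h + (lam : ℂ) • M h, x⟫_ℂ - ⟪M h, y + (lam : ℂ) • x⟫_ℂ = 0 := by
        refine ⟨fun hform h => hform _ _ ((hM _ h).1 rfl), fun hform u v huv => ?_⟩
        obtain ⟨h, rfl⟩ : ∃ h, v = h + (lam : ℂ) • u := ⟨v - (lam : ℂ) • u, by module⟩
        obtain rfl := (hM _ _).2 huv
        exact hform h
    _ ↔ ∀ h, ⟪h, x⟫_ℂ = ⟪h, M y⟫_ℂ := forall_congr' fun h => by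
        simp only [inner_add_left, inner_add_right, inner_smul_left, inner_smul_right,
          Complex.conj_ofReal, hsymm, map_add, map_smul]
        rw [add_sub_add_right_eq_sub, sub_eq_zero]
    _ ↔ M y = x := ⟨fun h => (ext_inner_left ℂ h).symm, fun h _ => by rw [h]⟩

end IsResolvent

end Resolvent

namespace BddMetric

variable {H : Type*} [NormedAddCommGroup H] [InnerProductSpace ℂ H] [CompleteSpace H]
  (B : BddMetric H)

/-! ### The spaces of the scale -/

theorem inner_op_pow (d : ℕ) (x y : H) : ⟪(B.op ^ d) x, y⟫_ℂ = ⟪x, (B.op ^ d) y⟫_ℂ :=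
  ContinuousLinearMap.isSelfAdjoint_iff_isSymmetric.1 (B.pos.isSelfAdjoint.pow d) x y

theorem denseRange_op_pow (d : ℕ) : DenseRange (B.op ^ d : H →L[ℂ] H) :=
  denseRange_of_isSelfAdjoint_of_injective (B.pos.isSelfAdjoint.pow d) <| by
    simpa only [FunLike.coe_pow_eq_iterate] using B.inj.iterate d

theorem coe_coreEquiv_pow (d : ℕ) (φ : B.core) :
    (((B.coreEquiv ^ d) φ : B.core) : H) = (B.op ^ d) (φ : H) := by
  induction d with
  | zero => rfl
  | succ d ih =>
    rw [pow_succ' B.op, mul_apply_eq_comp, ← ih, pow_succ']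
    rfl

theorem unitary_op_pow (n : ℤ) (d : ℕ) (η : H) :
    B.unitary n ((B.op ^ d) η) = B.unitary (n + d) η := by
  ext φ
  rw [unitary_apply, unitary_apply, ← inner_op_pow, add_comm, zpow_add, zpow_natCast,
    ← coe_coreEquiv_pow]
  rfl

theorem unitary_add (n i : ℤ) (η : H) (φ : B.core) :
    B.unitary (n + i) η φ = B.unitary n η ((B.coreEquiv ^ i) φ) := by
  rw [unitary_apply, zpow_add]
  rfl

theorem unitary_mem (n : ℤ) (η : H) : B.unitary n η ∈ B.space n := ⟨η, rfl⟩

theorem central_mem (ξ : H) : B.central ξ ∈ B.space 0 := B.unitary_mem 0 ξ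

theorem central_injective : Function.Injective B.central := B.unitary_injective 0

theorem unitary_coord (n : ℤ) (f : B.space n) : B.unitary n (B.coord n f) = f :=
  congrArg Subtype.val ((B.coord n).symm_apply_apply f)

theorem coord_eq_iff {n : ℤ} {f : B.space n} {η : H} :
    B.coord n f = η ↔ (f : B.Ambient) = B.unitary n η := by
  rw [← B.unitary_coord n f]
  exact (B.unitary_injective n).eq_iff.symm

theorem coord_eq_op_pow {r s : ℤ} {d : ℕ} (h : r + d = s) (f : B.space r) (f' : B.space s)
    (hf : (f : B.Ambient) = f') : B.coord r f = (B.op ^ d) (B.coord s f') := by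
  rw [coord_eq_iff, unitary_op_pow, h, unitary_coord, hf]

theorem space_anti {r s : ℤ} (h : r ≤ s) : B.space s ≤ B.space r := by
  rintro _ ⟨η, rfl⟩
  obtain ⟨d, rfl⟩ := Int.le.dest h
  rw [← unitary_op_pow]
  exact B.unitary_mem r _

theorem space_add_le {r s : ℤ} (h : B.space r ≤ B.space s) (i : ℤ) :
    B.space (r + i) ≤ B.space (s + i) := by
  rintro _ ⟨η, rfl⟩
  obtain ⟨ζ, hζ⟩ := h (B.unitary_mem r η)
  exact ⟨ζ, LinearMap.ext fun φ => by rw [unitary_add, unitary_add, hζ]⟩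

theorem space_neg_le_neg {r s : ℤ} (h : B.space r ≤ B.space s) :
    B.space (-s) ≤ B.space (-r) := by
  have hshift := B.space_add_le h (-r - s)
  rwa [show r + (-r - s) = -s by ring, show s + (-r - s) = -r by ring] at hshift

theorem space_zero_le_neg {n : ℤ} (h : B.space n ≤ B.space 0) : B.space 0 ≤ B.space (-n) := by
  simpa only [neg_zero] using B.space_neg_le_neg h

theorem space_le_zero_of_le_neg {k : ℤ} (h : B.space k ≤ B.space (-k)) : B.space k ≤ B.space 0 := by
  rcases le_total 0 k with hk | hk
  · exact B.space_anti hk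
  · exact h.trans (B.space_anti (neg_nonneg.2 hk))

theorem central_mem_space_of_mem_core {ξ : H} (hξ : ξ ∈ B.core) (k : ℤ) :
    B.central ξ ∈ B.space k := by
  refine B.space_anti k.le_natAbs ?_
  obtain ⟨η, rfl⟩ := B.mem_core.1 hξ k.natAbs
  rw [central, unitary_op_pow, zero_add]
  exact B.unitary_mem _ η

/-- The operator `Sⁿ : H_n → H` as an isometric isomorphism. -/
def coordIsometry (n : ℤ) : B.space n ≃ₗᵢ[ℂ] H where
  toLinearEquiv := B.coord n
  norm_map' _ := rfl

instance instCompleteSpaceSpace (n : ℤ) : CompleteSpace (B.space n) :=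
  (completeSpace_congr (e := (B.coord n).toEquiv)
    (B.coordIsometry n).isometry.isUniformInducing.isUniformEmbedding).2 inferInstance

theorem continuous_apply {n : ℤ} (φ : B.core) :
    Continuous fun f : B.space n => (f : B.Ambient) φ := by
  have hinner (f : B.space n) :
      (f : B.Ambient) φ = ⟪(((B.coreEquiv ^ n) φ : B.core) : H), B.coordIsometry n f⟫_ℂ := by
    conv_lhs => rw [← B.unitary_coord n f]
    rfl
  simp only [hinner]
  exact continuous_const.inner (B.coordIsometry n).continuous

/-- The inclusion of one space of the scale in another as a bounded operator; it is bounded by the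
closed graph theorem. -/
def inclusionCLM {r s : ℤ} (h : B.space r ≤ B.space s) : B.space r →L[ℂ] B.space s :=
  ContinuousLinearMap.ofSeqClosedGraph (g := Submodule.inclusion h) fun _ x y hu hy =>
    Subtype.ext <| LinearMap.ext fun φ =>
      tendsto_nhds_unique (((B.continuous_apply φ).tendsto y).comp hy)
        (((B.continuous_apply φ).tendsto x).comp hu)

theorem inner_coord_eq {r s r' s' : ℤ} (h : r + s = r' + s') {f : B.space r} {g : B.space s}
    {f' : B.space r'} {g' : B.space s'} (hf : (f : B.Ambient) = f') (hg : (g : B.Ambient) = g') :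
    ⟪B.coord r f, B.coord s g⟫_ℂ = ⟪B.coord r' f', B.coord s' g'⟫_ℂ := by
  rcases le_total r r' with hr | hr <;> obtain ⟨d, hd⟩ := Int.le.dest hr
  · rw [B.coord_eq_op_pow hd f f' hf, B.coord_eq_op_pow (d := d) (by omega) g' g hg.symm,
      inner_op_pow]
  · rw [B.coord_eq_op_pow hd f' f hf.symm, B.coord_eq_op_pow (d := d) (by omega) g g' hg,
      inner_op_pow]

/-- The embedding of a space of the scale contained in `H_0` into the Hilbert space `H`. -/
def toCentral {k : ℤ} (h : B.space k ≤ B.space 0) : B.space k →L[ℂ] H :=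
  (B.coordIsometry 0 : B.space 0 →L[ℂ] H) ∘L B.inclusionCLM h

theorem central_toCentral {k : ℤ} (h : B.space k ≤ B.space 0) (x : B.space k) :
    B.central (B.toCentral h x) = x := B.unitary_coord 0 (B.inclusionCLM h x)

theorem denseRange_toCentral {k : ℤ} (h : B.space k ≤ B.space 0) : DenseRange (B.toCentral h) :=
  B.dense_core.mono fun _ hξ => ⟨⟨_, B.central_mem_space_of_mem_core hξ k⟩,
    B.central_injective (B.central_toCentral h _)⟩

/-! ### Dual operators between the spaces of the scale -/

variable {B} {r s : ℤ}

theorem ext_pip {f f' : B.space (-s)} (h : ∀ g, B.pip s f g = B.pip s f' g) : f = f' := by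
  refine (B.coord (-s)).injective (ext_inner_right ℂ fun η => ?_)
  simpa only [pip, LinearEquiv.apply_symm_apply] using h ((B.coord s).symm η)

/-- An operator between spaces of the scale as the operator `Sʳ R S⁻ˢ` in `H`. -/
def inCoords (R : B.space s →L[ℂ] B.space r) : H →L[ℂ] H :=
  (B.coordIsometry r : B.space r →L[ℂ] H) ∘L R ∘L
    ((B.coordIsometry s).symm : H →L[ℂ] B.space s)

theorem inCoords_coord (R : B.space s →L[ℂ] B.space r) (x : B.space s) :
    inCoords R (B.coord s x) = B.coord r (R x) :=
  congrArg (fun y => B.coord r (R y)) ((B.coord s).symm_apply_apply x)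

/-- `R'` is the adjoint of `R` for the partial inner product. -/
def IsDual (R : B.space s →L[ℂ] B.space r) (R' : B.space (-r) →L[ℂ] B.space (-s)) : Prop :=
  ∀ x y, B.pip s (R' y) x = B.pip r y (R x)

theorem exists_isDual (R : B.space s →L[ℂ] B.space r) :
    ∃ R' : B.space (-r) →L[ℂ] B.space (-s), IsDual R R' := by
  refine ⟨((B.coordIsometry (-s)).symm : H →L[ℂ] B.space (-s)) ∘L (inCoords R).adjoint ∘L
    (B.coordIsometry (-r) : B.space (-r) →L[ℂ] H), fun x y => ?_⟩
  calc ⟪B.coord (-s) ((B.coord (-s)).symm ((inCoords R).adjoint (B.coord (-r) y))),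
          B.coord s x⟫_ℂ
      = ⟪(inCoords R).adjoint (B.coord (-r) y), B.coord s x⟫_ℂ := by
        rw [LinearEquiv.apply_symm_apply]
    _ = ⟪B.coord (-r) y, B.coord r (R x)⟫_ℂ := by
        rw [ContinuousLinearMap.adjoint_inner_left, inCoords_coord]

/-- The operator `T - z` from `H_s` to `H_r`, where `H_s ⊆ H_r`. -/
def shift (T : B.space s →L[ℂ] B.space r) (z : ℂ) (h : B.space s ≤ B.space r) :
    B.space s →L[ℂ] B.space r :=
  T - z • B.inclusionCLM h

namespace IsDual

theorem leftInverse {P : B.space s →L[ℂ] B.space r} {P' : B.space (-r) →L[ℂ] B.space (-s)}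
    {R : B.space r →L[ℂ] B.space s} {R' : B.space (-s) →L[ℂ] B.space (-r)} (hP : IsDual P P')
    (hR : IsDual R R') (h : Function.LeftInverse R P) : Function.LeftInverse P' R' := fun y =>
  ext_pip fun x => by rw [hP, hR, h]

theorem shift {T : B.space s →L[ℂ] B.space r} {T' : B.space (-r) →L[ℂ] B.space (-s)}
    (hT : IsDual T T') (lam : ℝ) (h : B.space s ≤ B.space r) :
    IsDual (shift T lam h) (shift T' lam (B.space_neg_le_neg h)) := fun x y => by
  have hincl : B.pip s (B.inclusionCLM (B.space_neg_le_neg h) y) x =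
      B.pip r y (B.inclusionCLM h x) := B.inner_coord_eq (by ring) rfl rfl
  have hTT' := hT x y
  simp only [pip] at hincl hTT'
  simp only [pip, BddMetric.shift, FunLike.coe_sub, FunLike.coe_smul, Pi.sub_apply, Pi.smul_apply,
    map_sub, map_smul, inner_sub_left, inner_sub_right, inner_smul_left, inner_smul_right,
    Complex.conj_ofReal, hincl, hTT']

end IsDual

end BddMetric

namespace BddMetric

variable {H : Type*} [NormedAddCommGroup H] [InnerProductSpace ℂ H] [CompleteSpace H]
  {B : BddMetric H} {A F : B.Ambient →ₗ.[ℂ] B.Ambient} {r s r' s' : ℤ}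

/-! ### Resolvents in the scale -/

theorem IsRep.mem_graph_iff {T : B.space r →L[ℂ] B.space s} (hT : B.IsRep A r s T)
    {x : B.space r} {w : B.Ambient} : ((x : B.Ambient), w) ∈ A.graph ↔ (T x : B.Ambient) = w := by
  obtain ⟨hx, hAx⟩ := hT x
  rw [mem_graph_iff_exists, exists_prop_of_true hx, hAx]

/-- `R : H_s → H_r` is the inverse of the part of `A - z` that maps `H_r` into `H_s`. -/
def IsScaleResolvent (A : B.Ambient →ₗ.[ℂ] B.Ambient) (z : ℂ) (R : B.space s →L[ℂ] B.space r) :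
    Prop :=
  ∀ (x : B.space r) (y : B.space s),
    R y = x ↔ ((x : B.Ambient), (y : B.Ambient) + z • (x : B.Ambient)) ∈ A.graph

theorem IsRep.isScaleResolvent {T : B.space r →L[ℂ] B.space s} (hT : B.IsRep A r s T) {z : ℂ}
    (h : B.space r ≤ B.space s) {R : B.space s →L[ℂ] B.space r}
    (hl : Function.LeftInverse R (shift T z h)) (hr : Function.RightInverse R (shift T z h)) :
    IsScaleResolvent A z R := fun x y =>
  calc R y = x ↔ shift T z h x = y :=
        ⟨fun hx => hx ▸ hr y, fun hy => hy ▸ hl x⟩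
    _ ↔ T x = y + z • B.inclusionCLM h x := sub_eq_iff_eq_add
    _ ↔ (T x : B.Ambient) = y + z • (x : B.Ambient) := Subtype.ext_iff
    _ ↔ _ := hT.mem_graph_iff.symm

namespace IsScaleResolvent

variable {z : ℂ} {R : B.space s →L[ℂ] B.space r} {R' : B.space s' →L[ℂ] B.space r'}

theorem coe_eq_iff (hR : IsScaleResolvent A z R) {x : B.Ambient} {y : B.space s} :
    (R y : B.Ambient) = x ↔ x ∈ B.space r ∧ (x, (y : B.Ambient) + z • x) ∈ A.graph :=
  ⟨fun h => h ▸ ⟨(R y).2, (hR _ y).1 rfl⟩,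
    fun ⟨hx, hgraph⟩ => congrArg Subtype.val ((hR ⟨x, hx⟩ y).2 hgraph)⟩

theorem coe_eq_coe (hR : IsScaleResolvent A z R) (hR' : IsScaleResolvent A z R')
    {y : B.space s} {y' : B.space s'} (hy : (y : B.Ambient) = y') :
    (R y : B.Ambient) = R' y' := by
  rcases le_total r r' with h | h
  · exact hR.coe_eq_iff.2 ⟨B.space_anti h (R' y').2, hy ▸ (hR' _ y').1 rfl⟩
  · exact (hR'.coe_eq_iff.2 ⟨B.space_anti h (R y).2, hy ▸ (hR _ y).1 rfl⟩).symm

end IsScaleResolvent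

/-! ### Operators induced in the central Hilbert space -/

/-- The operator `M` in `H` acts on the vectors of `H` that lie in `H_s` as `R : H_s → H_r`. -/
def Induces (R : B.space s →L[ℂ] B.space r) (M : H →L[ℂ] H) : Prop :=
  ∀ (ξ : H) (h : B.central ξ ∈ B.space s), (R ⟨B.central ξ, h⟩ : B.Ambient) = B.central (M ξ)

theorem induces_of_eq_on_space {R : B.space s →L[ℂ] B.space r} {M : H →L[ℂ] H} {k : ℤ}
    (hk : B.space k ≤ B.space 0) (hks : B.space k ≤ B.space s) (h0 : B.space 0 ≤ B.space s)
    (h : ∀ x, (R (B.inclusionCLM hks x) : B.Ambient) = B.central (M (B.toCentral hk x))) :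
    Induces R M := by
  intro ξ hξ
  ext φ
  let e : H →L[ℂ] B.space 0 := ((B.coordIsometry 0).symm : H →L[ℂ] B.space 0)
  have hcont : Continuous fun η => (R (B.inclusionCLM h0 (e η)) : B.Ambient) φ :=
    (B.continuous_apply φ).comp (R ∘L B.inclusionCLM h0 ∘L e).continuous
  have hcont' : Continuous fun η => B.central (M η) φ :=
    (B.continuous_apply φ).comp (e ∘L M).continuous
  refine congrFun ((B.denseRange_toCentral hk).equalizer hcont hcont' (funext fun x => ?_)) ξ
  have hx : B.inclusionCLM h0 (e (B.toCentral hk x)) = B.inclusionCLM hks x :=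
    Subtype.ext (B.central_toCentral hk x)
  simp only [Function.comp_apply, hx, h]

theorem Induces.of_coe_eq {R : B.space s →L[ℂ] B.space r} {R' : B.space s' →L[ℂ] B.space r'}
    {M : H →L[ℂ] H} (hR : Induces R M) (hss' : B.space s' ≤ B.space s)
    (h : ∀ x : B.space s', (R' x : B.Ambient) = R (B.inclusionCLM hss' x)) : Induces R' M :=
  fun ξ hξ => (h _).trans (hR ξ (hss' hξ))

theorem IsDual.exists_isSelfAdjoint_of_restrict {R : B.space s →L[ℂ] B.space r}
    {R' : B.space (-r) →L[ℂ] B.space (-s)} (hRR' : IsDual R R') {k : ℤ}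
    (hk : B.space k ≤ B.space 0) (hks : B.space k ≤ B.space s) (hkr : B.space k ≤ B.space (-r))
    (L : B.space k →L[ℂ] B.space k)
    (hL : ∀ x, (L x : B.Ambient) = R (B.inclusionCLM hks x))
    (hL' : ∀ x, (L x : B.Ambient) = R' (B.inclusionCLM hkr x)) :
    ∃ M : H →L[ℂ] H, IsSelfAdjoint M ∧
      (B.space 0 ≤ B.space s → Induces R M) ∧ (B.space 0 ≤ B.space (-r) → Induces R' M) := by
  have hsymm (x y : B.space k) : ⟪B.toCentral hk (L x), B.toCentral hk y⟫_ℂ =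
      ⟪B.toCentral hk x, B.toCentral hk (L y)⟫_ℂ :=
    calc ⟪B.toCentral hk (L x), B.toCentral hk y⟫_ℂ
        = B.pip s (R' (B.inclusionCLM hkr x)) (B.inclusionCLM hks y) :=
          B.inner_coord_eq (by ring) (hL' x) rfl
      _ = B.pip r (B.inclusionCLM hkr x) (R (B.inclusionCLM hks y)) := hRR' _ _
      _ = ⟪B.toCentral hk x, B.toCentral hk (L y)⟫_ℂ :=
          B.inner_coord_eq (by ring) rfl (hL y).symm
  obtain ⟨M, hM, hML⟩ := exists_isSelfAdjoint_of_symmetrizable (B.denseRange_toCentral hk) L hsymm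
  refine ⟨M, hM, fun h0 => induces_of_eq_on_space hk hks h0 fun x => ?_,
    fun h0 => induces_of_eq_on_space hk hkr h0 fun x => ?_⟩
  · rw [hML, central_toCentral, hL]
  · rw [hML, central_toCentral, hL']

theorem IsDual.exists_isSelfAdjoint_induces {R : B.space s →L[ℂ] B.space r}
    {R' : B.space (-r) →L[ℂ] B.space (-s)} (hRR' : IsDual R R') (hrs : B.space r ≤ B.space s)
    (hcoe : ∀ {y : B.space s} {y' : B.space (-r)}, (y : B.Ambient) = y' →
      (R y : B.Ambient) = R' y') :
    ∃ M : H →L[ℂ] H, IsSelfAdjoint M ∧ Induces R M ∧ Induces R' M := by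
  have hsr : B.space (-s) ≤ B.space (-r) := B.space_neg_le_neg hrs
  rcases le_total (-s) r with h | h
  · have hk : B.space r ≤ B.space 0 := B.space_le_zero_of_le_neg ((B.space_anti h).trans hsr)
    obtain ⟨M, hM, -, hR'M⟩ := hRR'.exists_isSelfAdjoint_of_restrict hk hrs
      ((B.space_anti h).trans hsr) (R ∘L B.inclusionCLM hrs) (fun _ => rfl) fun _ => hcoe rfl
    have hInd := hR'M (B.space_zero_le_neg hk)
    exact ⟨M, hM, hInd.of_coe_eq (B.space_anti (neg_le.1 h)) fun _ => hcoe rfl, hInd⟩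
  · have hle : B.space (-s) ≤ B.space s := (B.space_anti h).trans hrs
    have hk : B.space (-s) ≤ B.space 0 :=
      B.space_le_zero_of_le_neg (by rwa [neg_neg])
    obtain ⟨M, hM, hRM, -⟩ := hRR'.exists_isSelfAdjoint_of_restrict hk hle hsr
      (R' ∘L B.inclusionCLM hsr) (fun _ => (hcoe rfl).symm) fun _ => rfl
    have hInd := hRM (by simpa only [neg_neg] using B.space_zero_le_neg hk)
    exact ⟨M, hM, hInd, hInd.of_coe_eq (B.space_anti (le_neg.1 h)) fun _ => (hcoe rfl).symm⟩

/-! ### Compact embeddings -/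

theorem finiteDimensional_of_isCompactOperator_inclusion (hrs : r ≤ s) {h : B.space r ≤ B.space s}
    (hcpt : IsCompactOperator (Submodule.inclusion h)) : FiniteDimensional ℂ H := by
  have hid : IsCompactOperator (id : B.space r → B.space r) :=
    hcpt.clm_comp (B.inclusionCLM (B.space_anti hrs))
  have := FiniteDimensional.of_isCompactOperator_id (𝕜 := ℂ) hid
  exact (B.coord r).finiteDimensional

theorem isCompactOperator_op_pow_of_inclusion {d : ℕ} (hd : s + d = r)
    {h : B.space r ≤ B.space s} (hcpt : IsCompactOperator (Submodule.inclusion h)) :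
    IsCompactOperator (B.op ^ d) := by
  have hcomp := (hcpt.comp_clm ((B.coordIsometry r).symm : H →L[ℂ] B.space r)).clm_comp
    (B.coordIsometry s : B.space s →L[ℂ] H)
  refine (congrArg IsCompactOperator (funext fun η => ?_)).mp hcomp
  exact (B.coord_eq_op_pow hd (Submodule.inclusion h ((B.coord r).symm η)) _ rfl).trans
    (congrArg (B.op ^ d) ((B.coord r).apply_symm_apply η))

theorem Induces.isCompactOperator {R : B.space s →L[ℂ] B.space r} {M : H →L[ℂ] H}
    (hRM : Induces R M) (hM : IsSelfAdjoint M) (hr : 0 ≤ r) {d : ℕ} (hd : s + d = r)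
    (hcpt : IsCompactOperator (B.op ^ d)) : IsCompactOperator M := by
  lift r to ℕ using hr
  have hr (η : H) : B.central ((B.op ^ r) η) = B.unitary r η := by
    rw [central, unitary_op_pow, zero_add]
  refine isCompactOperator_of_intertwining (J := B.op ^ r) (X := inCoords R)
    (B.pos.isSelfAdjoint.pow d) hcpt (B.denseRange_op_pow r)
    (Commute.pow_pow (Commute.refl B.op) d r) hM ?_
  ext η
  let x : B.space s := ⟨B.central ((B.op ^ r) η), by
    rw [hr, ← hd, ← unitary_op_pow]; exact B.unitary_mem s _⟩
  have hx : B.coord s x = (B.op ^ d) η := by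
    rw [coord_eq_iff, unitary_op_pow, hd]
    exact hr η
  refine B.central_injective ?_
  calc B.central (M ((B.op ^ r) η)) = R x := (hRM _ x.2).symm
    _ = B.unitary r (inCoords R ((B.op ^ d) η)) := by rw [← hx, inCoords_coord, unitary_coord]
    _ = B.central ((B.op ^ r) (inCoords R ((B.op ^ d) η))) := (hr _).symm

theorem isCompactOperator_of_induces {R : B.space s →L[ℂ] B.space r}
    {R' : B.space (-r) →L[ℂ] B.space (-s)} {M : H →L[ℂ] H} (hM : IsSelfAdjoint M)
    (hRM : Induces R M) (hR'M : Induces R' M) {h : B.space r ≤ B.space s}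
    (hcpt : IsCompactOperator (Submodule.inclusion h)) : IsCompactOperator M := by
  rcases le_total r s with hrs | hsr
  · have := finiteDimensional_of_isCompactOperator_inclusion hrs hcpt
    exact (isCompactOperator_id_iff_finiteDimensional.2 this).comp_clm M
  obtain ⟨d, hd⟩ := Int.le.dest hsr
  have hpow := isCompactOperator_op_pow_of_inclusion hd hcpt
  rcases le_total (-s) r with hr | hr
  · exact hRM.isCompactOperator hM (by omega) hd hpow
  · exact hR'M.isCompactOperator hM (by omega) (by omega) hpow

/-! ### The part of an operator in the central Hilbert space -/

/-- The part of `F` in `H`: the operator `ξ ↦ F ξ` on the set of the `ξ ∈ H` with `F ξ ∈ H`. -/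
def part (F : B.Ambient →ₗ.[ℂ] B.Ambient) : H →ₗ.[ℂ] H :=
  (F.graph.comap (B.central.prodMap B.central)).toLinearPMap

theorem mem_graph_part {x y : H} :
    (x, y) ∈ (part F).graph ↔ (B.central x, B.central y) ∈ F.graph := by
  have hgraph : (part F).graph = F.graph.comap (B.central.prodMap B.central) := by
    refine Submodule.toLinearPMap_graph_eq _ fun p hp hp1 => B.central_injective ?_
    rw [map_zero]
    exact F.graph_fst_eq_zero_snd hp ((congrArg B.central hp1).trans (map_zero _))
  rw [hgraph]
  rfl

theorem isRestriction_iff_le_part {a : H →ₗ.[ℂ] H} : B.IsRestriction a F ↔ a ≤ part F := by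
  rw [← LinearPMap.le_graph_iff]
  constructor
  · rintro h ⟨x, y⟩ hxy
    obtain ⟨hx, rfl⟩ := mem_graph_iff_exists.1 hxy
    exact mem_graph_part.2 (mem_graph_iff_exists.2 (h ⟨x, hx⟩))
  · exact fun h ξ => mem_graph_iff_exists.1 (mem_graph_part.1 (h (a.mem_graph ξ)))

theorem coe_domain_part : ((part F).domain : Set H) = B.domainInH F := by
  ext ξ
  refine LinearPMap.mem_domain_iff.trans ?_
  simp_rw [mem_graph_part, mem_graph_iff_exists]
  exact ⟨fun ⟨η, h, hη⟩ => ⟨h, η, hη.symm⟩, fun ⟨h, η, hη⟩ => ⟨η, h, hη.symm⟩⟩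

theorem isResolvent_part {z : ℂ} {R : B.space s →L[ℂ] B.space r} (hR : IsScaleResolvent A z R)
    {M : H →L[ℂ] H} (hRM : Induces R M) (h0 : B.space 0 ≤ B.space s)
    (hF : ∀ x y : H, (B.central x, B.central y) ∈ F.graph ↔
      B.central x ∈ B.space r ∧ (B.central x, B.central y) ∈ A.graph) :
    IsResolvent (part F) z M := fun x y => by
  have hy : B.central y ∈ B.space s := h0 (B.central_mem y)
  rw [mem_graph_part, hF, map_add, map_smul, ← B.central_injective.eq_iff, ← hRM y hy]
  exact hR.coe_eq_iff

end BddMetric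

end PipKLMN

end

open PipKLMN PipKLMN.BddMetric in
theorem mainTheorem7_general {H : Type*} [NormedAddCommGroup H] [InnerProductSpace ℂ H]
    [CompleteSpace H] (B : BddMetric H) (A : B.Ambient →ₗ.[ℂ] B.Ambient)
    (m n : ℤ) (hmn : B.space m ≤ B.space n)
    (T : B.space m →L[ℂ] B.space n) (hT : B.IsRep A m n T)
    (T' : B.space (-n) →L[ℂ] B.space (-m)) (hT' : B.IsRep A (-n) (-m) T') (hTT' : IsDual T T')
    (lam : ℝ) (hlam : B.IsBddInvertible T (lam : ℂ) hmn)
    (F : B.Ambient →ₗ.[ℂ] B.Ambient)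
    (hF : (B.space 0 ≤ B.space n ∧ F = A.domRestrict (B.space m)) ∨
      (B.space n ≤ B.space 0 ∧ F = A)) :
    ∃ a : H →ₗ.[ℂ] H,
      (IsSelfAdjoint a ∧ B.IsRestriction a F) ∧
      (∀ b : H →ₗ.[ℂ] H, IsSelfAdjoint b → B.IsRestriction b F → b = a) ∧
      Dense (a.domain : Set H) ∧
      (a.domain : Set H) = B.domainInH F ∧
      (lam : ℂ) ∈ resolventSet a ∧
      (IsCompactOperator (Submodule.inclusion hmn) →
        spectrumSet a = pointSpectrum a ∧
        (∀ z ∈ pointSpectrum a, FiniteDimensional ℂ (eigenspace a z)) ∧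
        contSpectrum a = ∅) := by
  obtain ⟨R, hleft, hright⟩ := hlam
  obtain ⟨R', hRR'⟩ := exists_isDual R
  have hshift := hTT'.shift lam hmn
  have hR : IsScaleResolvent A lam R := hT.isScaleResolvent hmn hleft hright
  have hR' : IsScaleResolvent A lam R' := hT'.isScaleResolvent (B.space_neg_le_neg hmn)
    (hRR'.leftInverse hshift hright) (hshift.leftInverse hRR' hleft)
  obtain ⟨M, hM, hRM, hR'M⟩ := hRR'.exists_isSelfAdjoint_induces hmn (hR.coe_eq_coe hR')
  have hres : IsResolvent (part F) lam M := by
    rcases hF with ⟨h0, rfl⟩ | ⟨h0, rfl⟩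
    · exact isResolvent_part hR hRM h0 fun _ _ => mem_graph_domRestrict
    · exact isResolvent_part hR' hR'M (B.space_zero_le_neg (hmn.trans h0)) fun x _ =>
        (and_iff_right (B.space_zero_le_neg h0 (B.central_mem x))).symm
  have hsa : IsSelfAdjoint (part F) := hres.isSelfAdjoint hM
  refine ⟨part F, ⟨hsa, isRestriction_iff_le_part.2 le_rfl⟩, fun b hb hbF =>
    eq_of_le_of_isSelfAdjoint hsa hb (isRestriction_iff_le_part.1 hbF), hsa.dense_domain,
    coe_domain_part, hres.mem_resolventSet, fun hcpt => ?_⟩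
  have hMcpt : IsCompactOperator M := isCompactOperator_of_induces hM hRM hR'M hcpt
  have hmem (z : ℂ) (hz : z ∉ pointSpectrum (part F)) :
      z ∈ resolventSet (part F) :=
    hres.mem_resolventSet_of_notMem_pointSpectrum hMcpt hz
  exact ⟨spectrumSet_eq_pointSpectrum hmem,
    fun z _ => hres.finiteDimensional_eigenspace hMcpt z, contSpectrum_eq_empty hmem⟩

theorem mainTheorem7 {H : Type*} [NormedAddCommGroup H] [InnerProductSpace ℂ H] [CompleteSpace H]
    (G : H →ₗ.[ℂ] H) (hG : PipKLMN.IsMetricOperator G)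
    (B : PipKLMN.BddMetric H) (hB : PipKLMN.IsScaleGenerator G B)
    (A : B.Ambient →ₗ.[ℂ] B.Ambient) (hA : B.IsSymmetricOp A)
    (m n : ℤ) (hmn : B.space m ≤ B.space n)
    (T : B.space m →L[ℂ] B.space n) (hT : B.IsRep A m n T)
    (lam : ℝ) (hlam : B.IsBddInvertible T (lam : ℂ) hmn)
    (F : B.Ambient →ₗ.[ℂ] B.Ambient)
    (hF : (B.space 0 ≤ B.space n ∧ F = A.domRestrict (B.space m)) ∨
      (B.space n ≤ B.space 0 ∧ F = A)) :
    ∃ a : H →ₗ.[ℂ] H,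
      (IsSelfAdjoint a ∧ B.IsRestriction a F) ∧
      (∀ b : H →ₗ.[ℂ] H, IsSelfAdjoint b → B.IsRestriction b F → b = a) ∧
      Dense (a.domain : Set H) ∧
      (a.domain : Set H) = B.domainInH F ∧
      (lam : ℂ) ∈ PipKLMN.resolventSet a ∧
      (IsCompactOperator (Submodule.inclusion hmn) →
        PipKLMN.spectrumSet a = PipKLMN.pointSpectrum a ∧
        (∀ z ∈ PipKLMN.pointSpectrum a, FiniteDimensional ℂ (PipKLMN.eigenspace a z)) ∧
        PipKLMN.contSpectrum a = ∅) := by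
  obtain ⟨T', hT', hTT'⟩ := hA.2.2 m n T hT
  exact mainTheorem7_general B A m n hmn T hT T' hT' hTT' lam hlam F hF
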